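/- **Fixed-prime criterion: structural form.** Let $m\ge 3$ be an integer and let $D\subset\{0,1,\dots,m-1\}$ with $1<\#D<m$. Let $$K_{m,D}:=\Bigl\{\sum_{j=1}^\infty \frac{d_j}{m^j} : d_j\in D\text{ for all } j\ge 1\Bigr\},\qquad c_{m,D}:=2(m-1)\min\Bigl\{1,\frac{\#D}{m-\#D}\Bigr\}.$$ Write $\nu_p$ for the $p$-adic valuation, $\operatorname{rad}(q)$ for the product of the primes dividing $q$, and $\operatorname{ord}_q(u)$ for the multiplicative order of $u$ modulo $q$ (for $\gcd(u,q)=1$, with $\operatorname{ord}_1(u)=1$). Let $(a_n)_{n\ge1}$ be a sequence of positive integers and let $$Q_n:=\frac{a_n}{\prod_{p\mid m}p^{\nu_p(a_n)}}\qquad(p\text{ prime})$$ be the $m$-coprime part of $a_n$. Fix a prime $p_0\nmid m$ and put $$t(m,p_0):=\begin{cases}\nu_{p_0}\bigl(m^{\operatorname{ord}_{p_0}(m)}-1\bigr), & p_0\text{ odd},\\ \nu_2(m^2-1)-1, & p_0=2.\end{cases}$$ Suppose that $\alpha,\gamma:\mathbb{N}\to\mathbb{R}$ are functions and $N\ge1$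 is an integer such that for every $n\ge N$ $$\nu_{p_0}(Q_n)\ge\alpha(n),\qquad \nu_{p_0}\bigl(\operatorname{ord}_{\operatorname{rad}(Q_n)}(m)\bigr)\le\gamma(n),$$ and that $n_0\ge N$ is an integer such that for all $n\ge n_0$ $$\alpha(n)>t(m,p_0)+\gamma(n)+\log_{p_0}(c_{m,D}).$$ Then $\frac1{a_n}\notin K_{m,D}$ for every $n\ge n_0$. In particular, the set $\{\frac1{a_n}:n\ge 1\}\cap K_{m,D}$ is finite. -/

import Mathlib

namespace MissingDigit

/-- The missing-digit set `K_{m,D}`: the sums `∑_{j ≥ 1} d_j / m^j` with all digits `d_j ∈ D`.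
The digit `d_j` is stored at index `j - 1`. -/
def missingDigitSet (m : ℕ) (D : Finset ℕ) : Set ℝ :=
  {x | ∃ d : ℕ → ℕ, (∀ j, d j ∈ D) ∧ HasSum (fun j => (d j : ℝ) / (m : ℝ) ^ (j + 1)) x}

/-- The full `m`-part `(A, m^∞) = ∏_{p ∣ m} p ^ ν_p(A)` of `A`. -/
def mPart (A m : ℕ) : ℕ :=
  ∏ p ∈ m.primeFactors, p ^ padicValNat p A

/-- The `m`-coprime part `A / (A, m^∞)` of `A ≥ 1`; the division is exact. -/
def coprimePart (A m : ℕ) : ℕ :=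
  A / mPart A m

/-- The multiplicative order of `u` modulo `q`; it is `1` for `q = 1`. -/
noncomputable def multOrder (q u : ℕ) : ℕ :=
  orderOf (u : ZMod q)

/-- The constant `c_{m,D} = 2 (m - 1) min {1, #D / (m - #D)}`. -/
noncomputable def korobovConst (m : ℕ) (D : Finset ℕ) : ℝ :=
  2 * ((m : ℝ) - 1) * min 1 ((D.card : ℝ) / ((m : ℝ) - (D.card : ℝ)))

/-- The overhead parameter `t(m, p₀)`. For `m ≥ 3` and a prime `p₀ ∤ m` no subtraction truncates. -/
noncomputable def overhead (m p₀ : ℕ) : ℕ :=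
  if p₀ = 2 then padicValNat 2 (m ^ 2 - 1) - 1
  else padicValNat p₀ (m ^ multOrder p₀ m - 1)

end MissingDigit

namespace MissingDigit

/-! The argument is a pigeonhole on orbits. Suppose `1 / A` has all its digits in `D`, and let `v`
be the `p`-adic valuation of its coprime part, with `p ∤ m`. In the relevant range `p ∣ A`, so `A`
divides no power of `m` and the digits are the first digits of the points `(m ^ k % A) / A`
(`digit_eq_of_hasSum`).

Lifting the exponent gives `L` and `b` such that the powers of `m ^ L` are `1` modulo the
prime-to-`p` part, while `m ^ (L * i) - 1` has valuation `b + ν_p(i)` (`exists_exponent`). Hence the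
orbit contains a full residue class modulo `A / p ^ (v - b)`, that is, `p ^ (v - b)` equally spaced
points. These show every digit or at least `p ^ (v - b)` distinct ones; as `#D < m`, this forces `p
^ (v - b) ≤ #D`.

Since `p ^ b ≤ 2 * p ^ (t + g)`, where `t` is the overhead and `g` the valuation of the order modulo
the radical, and `2 * #D ≤ korobovConst m D`, the logarithmic hypothesis contradicts this. -/

lemma mPart_dvd (A m : ℕ) : mPart A m ∣ A := by
  refine Finset.prod_dvd_of_isRelPrime ?_ fun p _ => pow_padicValNat_dvd
  intro p hp q hq hpq
  exact Nat.coprime_iff_isRelPrime.mp <| Nat.Coprime.pow _ _ <|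
    (Nat.coprime_primes (Nat.prime_of_mem_primeFactors hp)
      (Nat.prime_of_mem_primeFactors hq)).mpr hpq

lemma mPart_mul_coprimePart (A m : ℕ) : mPart A m * coprimePart A m = A :=
  Nat.mul_div_cancel' (mPart_dvd A m)

lemma mPart_dvd_pow {A : ℕ} (hA : A ≠ 0) (m : ℕ) : mPart A m ∣ m ^ A := by
  refine dvd_trans (b := ∏ p ∈ m.primeFactors, p ^ A)
    (Finset.prod_dvd_prod_of_dvd _ _ fun p _ => pow_dvd_pow p (Nat.padicValNat_lt_self hA).le) ?_
  rw [Finset.prod_pow]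
  exact pow_dvd_pow_of_dvd (Nat.prod_primeFactors_dvd m) A

lemma coprime_coprimePart {A m : ℕ} (hA : A ≠ 0) (hm : m ≠ 0) : Nat.Coprime m (coprimePart A m) := by
  refine Nat.coprime_of_dvd fun p hp hpm hpQ => ?_
  have := Fact.mk hp
  have h1 : p ^ padicValNat p A ∣ mPart A m :=
    Finset.dvd_prod_of_mem (fun p => p ^ padicValNat p A) (Nat.mem_primeFactors.mpr ⟨hp, hpm, hm⟩)
  refine pow_succ_padicValNat_not_dvd (p := p) hA ?_
  rw [pow_succ]
  exact (mul_dvd_mul h1 hpQ).trans (mPart_mul_coprimePart A m).dvd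

/-! ### Digits of `1 / A` by long division -/

lemma hasSum_geometric_digits {m : ℕ} (hm : 2 ≤ m) :
    HasSum (fun j : ℕ => ((m : ℝ) - 1) / (m : ℝ) ^ (j + 1)) 1 := by
  have hm' : (2 : ℝ) ≤ m := by exact_mod_cast hm
  have h := (hasSum_geometric_of_lt_one (r := ((m : ℝ))⁻¹) (by positivity)
    (inv_lt_one_of_one_lt₀ (by linarith))).mul_left (((m : ℝ) - 1) / m)
  have hval : (1 : ℝ) = ((m : ℝ) - 1) / m * (1 - (m : ℝ)⁻¹)⁻¹ := by
    have : (m : ℝ) - 1 ≠ 0 := by linarith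
    field_simp
  rw [← hval] at h
  refine h.congr_fun fun j => ?_
  rw [inv_pow, pow_succ]
  field_simp

/-- If no power of `m` is divisible by `A`, an expansion of `1 / A` in base `m` is the one produced
by long division. -/
lemma digit_eq_of_hasSum {m A : ℕ} (hm : 2 ≤ m) (hA : 1 < A) (hdiv : ∀ k, ¬ A ∣ m ^ k)
    {d : ℕ → ℕ} (hd : ∀ j, d j < m)
    (hs : HasSum (fun j => (d j : ℝ) / (m : ℝ) ^ (j + 1)) (1 / (A : ℝ))) (k : ℕ) :
    d k = m * (m ^ k % A) / A := by
  have hm0 : (0 : ℝ) < m := by exact_mod_cast (by omega : 0 < m)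
  have hA0 : (0 : ℝ) < A := by exact_mod_cast (by omega : 0 < A)
  have step : ∀ k, HasSum (fun j => (d (j + k) : ℝ) / (m : ℝ) ^ (j + 1)) (((m ^ k % A : ℕ) : ℝ) / A) →
      d k = m * (m ^ k % A) / A ∧
      HasSum (fun j => (d (j + (k + 1)) : ℝ) / (m : ℝ) ^ (j + 1)) (((m ^ (k + 1) % A : ℕ) : ℝ) / A) := by
    intro k h
    set x := m ^ k % A with hx
    have h1 := ((hasSum_nat_add_iff' 1).mpr h).mul_left (m : ℝ)
    have h2 : HasSum (fun j => (d (j + (k + 1)) : ℝ) / (m : ℝ) ^ (j + 1))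
        (((m : ℝ) * x - d k * A) / A) := by
      have hval : ((m : ℝ) * x - d k * A) / A =
          m * ((x : ℝ) / A - ∑ i ∈ Finset.range 1, (d (i + k) : ℝ) / (m : ℝ) ^ (i + 1)) := by
        simp only [Finset.range_one, Finset.sum_singleton, zero_add, pow_one]
        field_simp
      rw [hval]
      refine h1.congr_fun fun j => ?_
      rw [pow_succ (m : ℝ) (j + 1), show j + (k + 1) = j + 1 + k by ring]
      field_simp
    have hnn : 0 ≤ ((m : ℝ) * x - d k * A) / A := h2.nonneg fun j => by positivity
    have hle : ((m : ℝ) * x - d k * A) / A ≤ 1 := by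
      refine hasSum_le (fun j => ?_) h2 (hasSum_geometric_digits hm)
      gcongr
      have : d (j + (k + 1)) + 1 ≤ m := hd _
      have : ((d (j + (k + 1)) : ℝ)) + 1 ≤ m := by exact_mod_cast this
      linarith
    rw [le_div_iff₀ hA0, zero_mul, sub_nonneg] at hnn
    rw [div_le_one hA0, sub_le_iff_le_add] at hle
    have hnn' : d k * A ≤ m * x := by exact_mod_cast hnn
    have hle' : m * x ≤ A + d k * A := by exact_mod_cast hle
    have hmod : m * x ≡ m ^ (k + 1) [MOD A] := by
      rw [pow_succ, mul_comm _ m]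
      exact Nat.ModEq.mul_left m (Nat.mod_modEq _ _)
    -- Equality is the ambiguous expansion whose tail consists only of the digit `m - 1`; it would
    -- make `A` divide `m ^ (k + 1)`.
    have hlt : m * x < A + d k * A := by
      refine lt_of_le_of_ne hle' fun he => hdiv (k + 1) ?_
      refine (hmod.dvd_iff dvd_rfl).mp ?_
      rw [he]
      exact ⟨1 + d k, by ring⟩
    have hdk : m * x / A = d k := by
      rw [Nat.div_eq_iff (by omega)]
      constructor
      · exact hnn'
      · omega
    refine ⟨hdk.symm, ?_⟩
    have hr : m ^ (k + 1) % A = m * x - d k * A := by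
      rw [← hmod, Nat.mod_eq_sub_mul_div, hdk, mul_comm A]
    rw [hr, Nat.cast_sub hnn']
    push_cast
    exact h2
  have all : ∀ k, HasSum (fun j => (d (j + k) : ℝ) / (m : ℝ) ^ (j + 1))
      (((m ^ k % A : ℕ) : ℝ) / A) := by
    intro k
    induction k with
    | zero => simpa [Nat.mod_eq_of_lt hA] using hs
    | succ k ih => exact (step k ih).2
  exact (step k (all k)).1

/-! ### First digits of equally spaced points -/

/-- `P` equally spaced points of `[0, 1)` have at least `min P m` distinct first digits. -/
lemma le_card_of_arith_prog_digits {m B P c : ℕ} {D : Finset ℕ} (hcB : c < B) (hP : 0 < P)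
    (hDm : D.card < m) (h : ∀ y < P, m * (c + B * y) / (B * P) ∈ D) : P ≤ D.card := by
  have hB : 0 < B := by omega
  have hBP : 0 < B * P := Nat.mul_pos hB hP
  rcases le_or_gt P m with hPm | hPm
  · have hmono : StrictMono fun y => m * (c + B * y) / (B * P) := by
      refine strictMono_nat_of_lt_succ fun y => ?_
      have : m * (c + B * y) + B * P ≤ m * (c + B * (y + 1)) := by nlinarith
      calc m * (c + B * y) / (B * P) < m * (c + B * y) / (B * P) + 1 := Nat.lt_succ_self _
        _ = (m * (c + B * y) + B * P) / (B * P) := (Nat.add_div_right _ hBP).symm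
        _ ≤ _ := Nat.div_le_div_right this
    simpa using Finset.card_le_card_of_injOn (s := Finset.range P) _
      (fun y hy => h y (Finset.mem_range.mp hy)) hmono.injective.injOn
  · exfalso
    -- With spacing below `1 / m`, the first digit climbs from `0` to `m - 1` by steps of at most
    -- one, so it skips no value.
    have hstep : ∀ y, m * (c + B * (y + 1)) / (B * P) ≤ m * (c + B * y) / (B * P) + 1 := by
      intro y
      rw [← Nat.add_div_right _ hBP]
      exact Nat.div_le_div_right (by nlinarith)
    have hzero : m * (c + B * 0) / (B * P) = 0 := Nat.div_eq_of_lt (by nlinarith)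
    have hlast : m - 1 ≤ m * (c + B * (P - 1)) / (B * P) := by
      rw [Nat.le_div_iff_mul_le hBP]
      obtain ⟨P, rfl⟩ : ∃ k, P = k + 1 := ⟨P - 1, by omega⟩
      obtain ⟨m, rfl⟩ : ∃ k, m = k + 1 := ⟨m - 1, by omega⟩
      simp only [Nat.add_sub_cancel]
      have : m ≤ P := by omega
      nlinarith [Nat.mul_le_mul_left B this]
    have hsurj : ∀ y, ∀ e ≤ m * (c + B * y) / (B * P), ∃ z ≤ y, m * (c + B * z) / (B * P) = e := by
      intro y
      induction y with
      | zero => intro e he; exact ⟨0, le_rfl, by omega⟩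
      | succ y ih =>
        intro e he
        rcases Nat.lt_or_ge (m * (c + B * y) / (B * P)) e with hlt | hge
        · exact ⟨y + 1, le_rfl, by have := hstep y; omega⟩
        · obtain ⟨z, hz, hze⟩ := ih e hge
          exact ⟨z, by omega, hze⟩
    have hsub : Finset.range m ⊆ D := by
      intro e he
      obtain ⟨z, hz, hze⟩ := hsurj (P - 1) e (by have := Finset.mem_range.mp he; omega)
      exact hze ▸ h z (by omega)
    have := Finset.card_le_card hsub
    simp at this
    omega

/-- Counting: a residue class modulo `B` has exactly `P` members below `B * P`, so `P` distinct ones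
exhaust it. -/
lemma mem_of_progression {P B c A : ℕ} (hA : A = B * P) {x : ℕ → ℕ}
    (hx : ∀ i < P, x i < A) (hmod : ∀ i < P, x i % B = c)
    (hinj : ∀ i < P, ∀ j < P, x i = x j → i = j) {y : ℕ} (hy : y < P) :
    ∃ i < P, x i = c + B * y := by
  have key : ∀ i < P, x i = c + B * (x i / B) := fun i hi => by
    conv_lhs => rw [← Nat.mod_add_div (x i) B, hmod i hi]
  have hsurj := Finset.surjOn_of_injOn_of_card_le (s := Finset.range P) (t := Finset.range P)
    (fun i => x i / B)
    (fun i hi => by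
      have := hx i (by simpa using hi)
      rw [hA] at this
      simpa using Nat.div_lt_of_lt_mul this)
    (fun i hi j hj hij => by
      have hi' : i < P := by simpa using hi
      have hj' : j < P := by simpa using hj
      refine hinj i hi' j hj' ?_
      rw [key i hi', key j hj']
      simp only at hij
      rw [hij])
    le_rfl
  obtain ⟨i, hi, hiy⟩ := hsurj (by simpa using hy)
  have hi' : i < P := by simpa using hi
  exact ⟨i, hi', by rw [key i hi']; simp only at hiy; rw [hiy]⟩

/-! ### Multiplicative orders and lifting the exponent -/

lemma dvd_pow_multOrder_sub_one {q m : ℕ} (hm : 0 < m) : q ∣ m ^ multOrder q m - 1 := by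
  rw [← Nat.modEq_iff_dvd' (Nat.one_le_pow _ _ hm), ← ZMod.natCast_eq_natCast_iff]
  push_cast
  exact (pow_orderOf_eq_one _).symm

lemma multOrder_dvd_iff {q m k : ℕ} (hm : 0 < m) : multOrder q m ∣ k ↔ q ∣ m ^ k - 1 := by
  rw [← Nat.modEq_iff_dvd' (Nat.one_le_pow _ _ hm), ← ZMod.natCast_eq_natCast_iff, multOrder,
    orderOf_dvd_iff_pow_eq_one]
  push_cast
  exact eq_comm

lemma multOrder_ne_zero {q m : ℕ} (hq : q ≠ 0) (h : Nat.Coprime m q) : multOrder q m ≠ 0 := by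
  have : NeZero q := ⟨hq⟩
  have hu : (m : ZMod q) = ((ZMod.unitOfCoprime m h : (ZMod q)ˣ) : ZMod q) := by simp
  rw [multOrder, hu, orderOf_units]
  exact (orderOf_pos _).ne'

/-- If `u` is `1` modulo the radical of `q`, a suitable power of `u` is `1` modulo `q`. -/
lemma dvd_pow_radical_pow_sub_one {q u : ℕ} (hq : q ≠ 0) (hu : 0 < u)
    (h : UniqueFactorizationMonoid.radical q ∣ u - 1) :
    q ∣ u ^ (UniqueFactorizationMonoid.radical q ^ q) - 1 := by
  set r := UniqueFactorizationMonoid.radical q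
  have h1 : (r : ℤ) ∣ (u : ℤ) - 1 := by
    have := Int.natCast_dvd_natCast.mpr h
    rwa [Nat.cast_sub hu, Nat.cast_one] at this
  -- Each `r`-th power gains one more factor `r` in `u - 1`.
  have h2 := dvd_sub_pow_of_dvd_sub h1 q
  have h3 : r ^ (q + 1) ∣ u ^ r ^ q - 1 := by
    rw [← Int.natCast_dvd_natCast, Nat.cast_sub (Nat.one_le_pow _ _ hu)]
    push_cast
    simpa using h2
  exact ((Nat.dvd_radical_pow_self hq).trans (pow_dvd_pow r (Nat.le_succ q))).trans h3

/-- Lifting the exponent from `m ^ multOrder p m`; the order divides `p - 1`, so it contributes no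
factor `p` to `L`. -/
lemma padicValNat_pow_sub_one_of_odd {m p : ℕ} (hm : 2 ≤ m) (hp : p.Prime) (hp2 : p ≠ 2)
    (hpm : ¬ p ∣ m) {L : ℕ} (hL : L ≠ 0) (hdvd : multOrder p m ∣ L) :
    padicValNat p (m ^ L - 1) = overhead m p + padicValNat p L := by
  have := Fact.mk hp
  obtain ⟨k, rfl⟩ := hdvd
  have ho : multOrder p m ≠ 0 := left_ne_zero_of_mul hL
  have hk : k ≠ 0 := right_ne_zero_of_mul hL
  have hov : padicValNat p (multOrder p m) = 0 := by
    refine padicValNat.eq_zero_of_not_dvd fun hd => ?_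
    have h1 : multOrder p m ∣ p - 1 :=
      ZMod.orderOf_dvd_card_sub_one (mt (ZMod.natCast_eq_zero_iff _ _).mp hpm)
    have := Nat.le_of_dvd (by have := hp.two_le; omega) (hd.trans h1)
    have := hp.two_le
    omega
  have hlte := padicValNat.pow_sub_pow (p := p) (hp.odd_of_ne_two hp2) (x := m ^ multOrder p m)
    (y := 1) (Nat.one_lt_pow ho hm) (dvd_pow_multOrder_sub_one (by omega))
    (fun h => hpm (hp.dvd_of_dvd_pow h)) hk
  rw [one_pow] at hlte
  rw [pow_mul, hlte, padicValNat.mul ho hk, hov, zero_add, overhead, if_neg hp2]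

/-- The `- 1` in the overhead at `2` offsets the factor `2` already counted in the even exponent
`L`. -/
lemma padicValNat_two_pow_sub_one_of_even {m : ℕ} (hm : 2 ≤ m) (h2m : ¬ 2 ∣ m) {L : ℕ} (hL : L ≠ 0)
    (hev : Even L) : padicValNat 2 (m ^ L - 1) = overhead m 2 + padicValNat 2 L := by
  have hlte := padicValNat.pow_two_sub_one (by omega) h2m hL hev
  have hsq : m ^ 2 - 1 = (m + 1) * (m - 1) := by simpa using Nat.sq_sub_sq m 1
  have h1 : 1 ≤ padicValNat 2 (m + 1) := one_le_padicValNat_of_dvd (by omega) (by omega)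
  rw [overhead, if_pos rfl, hsq, padicValNat.mul (by omega) (by omega)]
  omega

/-- The multiplicative structure of `m` modulo `Q`: some power `m ^ L` is `1` modulo the prime-to-`p`
part of `Q`, and the `p`-adic valuations of `m ^ (L * i) - 1` are controlled. -/
lemma exists_exponent {m p Q : ℕ} (hm : 2 ≤ m) (hp : p.Prime) (hpm : ¬ p ∣ m) (hQ : Q ≠ 0)
    (hmQ : Nat.Coprime m Q) (hpQ : p ∣ Q) :
    ∃ L b : ℕ, L ≠ 0 ∧ p ^ b ≤ 2 * p ^ (overhead m p +
        padicValNat p (multOrder (UniqueFactorizationMonoid.radical Q) m)) ∧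
      Q / p ^ padicValNat p Q ∣ m ^ L - 1 ∧
      ∀ i ≠ 0, padicValNat p (m ^ (L * i) - 1) = b + padicValNat p i := by
  have := Fact.mk hp
  set R := UniqueFactorizationMonoid.radical Q with hR
  set Q' := Q / p ^ padicValNat p Q with hQ'
  have hQ'Q : p ^ padicValNat p Q * Q' = Q := Nat.mul_div_cancel' pow_padicValNat_dvd
  have hQ'0 : Q' ≠ 0 := fun h => hQ (by rw [← hQ'Q, h, mul_zero])
  have hpQ' : ¬ p ∣ Q' := fun h => pow_succ_padicValNat_not_dvd (p := p) hQ (by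
    rw [pow_succ]
    exact (mul_dvd_mul_left _ h).trans hQ'Q.dvd)
  have hRdvd : R ∣ Q := UniqueFactorizationMonoid.radical_dvd_self
  have hℓ0 : multOrder R m ≠ 0 := multOrder_ne_zero UniqueFactorizationMonoid.radical_ne_zero
    (hmQ.coprime_dvd_right hRdvd)
  set ℓ := multOrder R m
  set r := UniqueFactorizationMonoid.radical Q' with hr
  have hrR : r ∣ R := UniqueFactorizationMonoid.radical_dvd_radical ⟨_, by rw [mul_comm, hQ'Q]⟩ hQ
  have hpR : p ∣ R :=
    (UniqueFactorizationMonoid.dvd_radical_iff_of_irreducible hp hQ).mpr hpQ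
  have hpr : ¬ p ∣ r ^ Q' := fun h =>
    hpQ' ((hp.dvd_of_dvd_pow h).trans UniqueFactorizationMonoid.radical_dvd_self)
  have hr0 : r ^ Q' ≠ 0 := fun h => hpr (h ▸ dvd_zero p)
  have hRℓ : R ∣ m ^ ℓ - 1 := dvd_pow_multOrder_sub_one (by omega)
  set L := ℓ * r ^ Q' with hLdef
  have hL0 : L ≠ 0 := mul_ne_zero hℓ0 hr0
  have hνL : padicValNat p L = padicValNat p ℓ := by
    rw [hLdef, padicValNat.mul hℓ0 hr0, padicValNat.eq_zero_of_not_dvd hpr, add_zero]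
  have hQ'L : Q' ∣ m ^ L - 1 := by
    rw [hLdef, pow_mul]
    exact dvd_pow_radical_pow_sub_one hQ'0 (by positivity) (hrR.trans hRℓ)
  have hpos : 0 < p ^ (overhead m p + padicValNat p ℓ) := by have := hp.pos; positivity
  by_cases hp2 : p = 2
  · subst hp2
    by_cases hev : Even L
    · refine ⟨L, overhead m 2 + padicValNat 2 ℓ, hL0, by omega, hQ'L, fun i hi => ?_⟩
      rw [padicValNat_two_pow_sub_one_of_even hm hpm (mul_ne_zero hL0 hi) (hev.mul_right i),
        padicValNat.mul hL0 hi, hνL, add_assoc]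
    -- Lifting at `2` needs an even exponent; doubling an odd `L` raises `b` by one, whence the
    -- factor `2` in the bound on `p ^ b`.
    · refine ⟨L * 2, overhead m 2 + padicValNat 2 ℓ + 1, by omega, by rw [pow_succ]; omega,
        hQ'L.trans ?_, fun i hi => ?_⟩
      · rw [pow_mul m L 2]
        simpa using Nat.sub_dvd_pow_sub_pow (m ^ L) 1 2
      · rw [padicValNat_two_pow_sub_one_of_even hm hpm (mul_ne_zero (by omega) hi)
          ((even_two.mul_left L).mul_right i), padicValNat.mul (by omega) hi,
          padicValNat.mul hL0 (by omega), hνL, padicValNat_self]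
        ring
  · have hoL : multOrder p m ∣ L := by
      refine Dvd.dvd.mul_right ?_ _
      exact (multOrder_dvd_iff (by omega)).mpr (hpR.trans hRℓ)
    refine ⟨L, overhead m p + padicValNat p ℓ, hL0, by omega, hQ'L, fun i hi => ?_⟩
    rw [padicValNat_pow_sub_one_of_odd hm hp hp2 hpm (mul_ne_zero hL0 hi) (hoL.mul_right i),
      padicValNat.mul hL0 hi, hνL, add_assoc]

/-! ### The orbit of `1 / A` fills a residue class -/

/-- The powers of `m` modulo `A` fill a residue class modulo `A / p ^ (v - b)`, so the first digits
of the orbit of `1 / A` take at least `min (p ^ (v - b)) m` values. -/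
lemma le_card_of_orbit_digits {m p A L b : ℕ} {D : Finset ℕ} (hm : 2 ≤ m) (hp : p.Prime)
    (hpm : ¬ p ∣ m) (hA : A ≠ 0) (hDm : D.card < m)
    (hL0 : L ≠ 0) (hb : b ≤ padicValNat p (coprimePart A m))
    (hL : coprimePart A m / p ^ padicValNat p (coprimePart A m) ∣ m ^ L - 1)
    (hval : ∀ i ≠ 0, padicValNat p (m ^ (L * i) - 1) = b + padicValNat p i)
    (hdig : ∀ k, m * (m ^ k % A) / A ∈ D) :
    p ^ (padicValNat p (coprimePart A m) - b) ≤ D.card := by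
  have := Fact.mk hp
  have hSQ := mPart_mul_coprimePart A m
  have hSm := mPart_dvd_pow hA m
  set S := mPart A m
  set Q := coprimePart A m
  set v := padicValNat p Q
  set Q' := Q / p ^ v
  have hQ'Q : p ^ v * Q' = Q := Nat.mul_div_cancel' pow_padicValNat_dvd
  have hpQ' : Nat.Coprime (p ^ b) Q' := by
    refine Nat.Coprime.pow_left b ((Nat.Prime.coprime_iff_not_dvd hp).mpr fun h => ?_)
    refine pow_succ_padicValNat_not_dvd (p := p) (n := Q) (fun h0 => hA (by rw [← hSQ, h0, mul_zero])) ?_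
    rw [pow_succ]
    exact (mul_dvd_mul_left _ h).trans hQ'Q.dvd
  set P := p ^ (v - b) with hPdef
  set B := S * (p ^ b * Q') with hBdef
  have hAB : A = B * P := by
    have : p ^ v = p ^ b * P := by rw [hPdef, ← pow_add, Nat.add_sub_cancel' hb]
    rw [← hSQ, ← hQ'Q, this, hBdef]
    ring
  have hP0 : 0 < P := pow_pos hp.pos _
  have hB0 : 0 < B := Nat.pos_of_ne_zero fun h => hA (by rw [hAB, h, zero_mul])
  have hBdvd : B ∣ m ^ A * (m ^ L - 1) := by
    refine mul_dvd_mul hSm (hpQ'.mul_dvd_of_dvd_of_dvd ?_ hL)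
    have h1 := hval 1 one_ne_zero
    rw [mul_one, padicValNat_one_right, add_zero] at h1
    exact h1 ▸ pow_padicValNat_dvd
  -- Starting at exponent `A` absorbs the `m`-part `S`, which divides `m ^ A`.
  have hclass : ∀ i, m ^ (A + L * i) ≡ m ^ A [MOD B] := by
    intro i
    refine ((Nat.modEq_iff_dvd' (Nat.pow_le_pow_right (by omega) (Nat.le_add_right _ _))).mpr ?_).symm
    have : m ^ (A + L * i) - m ^ A = m ^ A * (m ^ (L * i) - 1) := by
      rw [pow_add, Nat.mul_sub, mul_one]
    rw [this]
    refine hBdvd.trans (mul_dvd_mul_left _ ?_)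
    rw [pow_mul]
    simpa using Nat.sub_dvd_pow_sub_pow (m ^ L) 1 i
  have hlt : ∀ i j, i < j → j < P → m ^ (A + L * i) % A ≠ m ^ (A + L * j) % A := by
    intro i j hij hjP he
    obtain ⟨e, rfl⟩ := Nat.exists_eq_add_of_lt hij
    set f := e + 1 with hf
    have hd := (Nat.modEq_iff_dvd' (Nat.pow_le_pow_right (by omega)
      (by gcongr))).mp (show m ^ (A + L * i) ≡ m ^ (A + L * (i + e + 1)) [MOD A] from he)
    have hfac : m ^ (A + L * (i + e + 1)) - m ^ (A + L * i) =
        m ^ (A + L * i) * (m ^ (L * f) - 1) := by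
      rw [Nat.mul_sub, mul_one, ← pow_add]
      congr 2
      rw [hf]
      ring
    rw [hfac] at hd
    -- The factor `p ^ v` of `A` alone separates the points: a coincidence forces `P ∣ f`, although
    -- `0 < f < P`.
    have hpv : p ^ v ∣ m ^ (L * f) - 1 := by
      refine Nat.Coprime.dvd_of_dvd_mul_left ?_ (((Dvd.intro _ hQ'Q).trans (Dvd.intro_left _ hSQ)).trans hd)
      exact Nat.Coprime.pow _ _ ((Nat.Prime.coprime_iff_not_dvd hp).mpr hpm)
    have hle : v ≤ b + padicValNat p f := by
      rw [← hval f (by omega)]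
      refine (padicValNat_dvd_iff_le ?_).mp hpv
      have := Nat.one_lt_pow (mul_ne_zero hL0 (by omega : f ≠ 0)) hm
      omega
    have : P ∣ f := (pow_dvd_pow p (by omega)).trans pow_padicValNat_dvd
    have := Nat.le_of_dvd (by omega) this
    omega
  refine le_card_of_arith_prog_digits (c := m ^ A % B) (Nat.mod_lt _ hB0) hP0 hDm fun y hy => ?_
  obtain ⟨i, -, hi⟩ := mem_of_progression (x := fun i => m ^ (A + L * i) % A) (c := m ^ A % B) hAB
    (fun i _ => Nat.mod_lt _ (Nat.pos_of_ne_zero hA))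
    (fun i _ => by
      rw [Nat.mod_mod_of_dvd _ (Dvd.intro _ hAB.symm)]
      exact hclass i)
    (fun i hi j hj hij => by
      rcases lt_trichotomy i j with h | h | h
      · exact absurd hij (hlt i j h hj)
      · exact h
      · exact absurd hij.symm (hlt j i h hi)) hy
  rw [← hAB]
  have := hdig (A + L * i)
  rwa [hi] at this

/-! ### Comparison with the constant, and conclusion -/

/-- Both entries of the minimum suffice, since `#D ≤ m - 1` and `m - #D ≤ m - 1`. This turns the
pigeonhole bound into the stated criterion. -/
lemma two_mul_card_le_korobovConst {m : ℕ} {D : Finset ℕ} (hD : 1 < D.card) (hDm : D.card < m) :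
    2 * (D.card : ℝ) ≤ korobovConst m D := by
  have h1 : (1 : ℝ) < D.card := by exact_mod_cast hD
  have h2 : (D.card : ℝ) + 1 ≤ m := by exact_mod_cast hDm
  have h3 : (D.card : ℝ) ≤ ((m : ℝ) - 1) * min 1 ((D.card : ℝ) / ((m : ℝ) - (D.card : ℝ))) := by
    rw [mul_min_of_nonneg _ _ (by linarith), le_min_iff, mul_one, ← mul_div_assoc,
      le_div_iff₀ (by linarith)]
    exact ⟨by linarith, by nlinarith⟩
  rw [korobovConst]
  linarith

lemma one_div_notMem_missingDigitSet {m p A : ℕ} {D : Finset ℕ} (hm : 2 ≤ m)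
    (hD : D ⊆ Finset.range m) (hD_gt : 1 < D.card) (hD_lt : D.card < m) (hA : A ≠ 0)
    (hp : p.Prime) (hpm : ¬ p ∣ m)
    (h : 2 * D.card * p ^ (overhead m p + padicValNat p
        (multOrder (UniqueFactorizationMonoid.radical (coprimePart A m)) m)) <
      p ^ padicValNat p (coprimePart A m)) :
    1 / (A : ℝ) ∉ missingDigitSet m D := by
  rintro ⟨d, hdD, hsum⟩
  have := Fact.mk hp
  have hSQ := mPart_mul_coprimePart A m
  have hQ0 : coprimePart A m ≠ 0 := fun h0 => hA (by rw [← hSQ, h0, mul_zero])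
  have hpos : 0 < p ^ (overhead m p + padicValNat p
      (multOrder (UniqueFactorizationMonoid.radical (coprimePart A m)) m)) := pow_pos hp.pos _
  have hpQ : p ∣ coprimePart A m := by
    refine dvd_of_one_le_padicValNat (Nat.one_le_iff_ne_zero.mpr fun h0 => ?_)
    rw [h0, pow_zero] at h
    nlinarith
  obtain ⟨L, b, hL0, hbp, hL, hval⟩ :=
    exists_exponent hm hp hpm hQ0 (coprime_coprimePart hA (by omega)) hpQ
  set v := padicValNat p (coprimePart A m)
  have hlt : D.card * p ^ b < p ^ v := by nlinarith
  have hbv : b ≤ v := (Nat.pow_le_pow_iff_right hp.one_lt).mp (by nlinarith)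
  have hpA : p ∣ A := hpQ.trans (Dvd.intro_left _ hSQ)
  have hle := le_card_of_orbit_digits hm hp hpm hA hD_lt hL0 hbv hL hval fun k => by
    rw [← digit_eq_of_hasSum hm (hp.one_lt.trans_le (Nat.le_of_dvd (by omega) hpA))
      (fun k hk => hpm (hp.dvd_of_dvd_pow (hpA.trans hk)))
      (fun j => Finset.mem_range.mp (hD (hdD j))) hsum k]
    exact hdD k
  refine absurd hlt (not_lt.mpr ?_)
  calc p ^ v = p ^ (v - b) * p ^ b := by rw [← pow_add, Nat.sub_add_cancel hbv]
    _ ≤ D.card * p ^ b := Nat.mul_le_mul_right _ hle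

end MissingDigit

theorem mainTheorem1 (m : ℕ) (hm : 3 ≤ m) (D : Finset ℕ) (hD : D ⊆ Finset.range m)
    (hD_gt : 1 < D.card) (hD_lt : D.card < m)
    (a : ℕ → ℕ) (ha : ∀ n, 1 ≤ n → 1 ≤ a n)
    (p₀ : ℕ) (hp₀ : p₀.Prime) (hp₀m : ¬ p₀ ∣ m)
    (α γ : ℕ → ℝ) (N : ℕ) (hN : 1 ≤ N)
    (hα : ∀ n, N ≤ n → α n ≤ (padicValNat p₀ (MissingDigit.coprimePart (a n) m) : ℝ))
    (hγ : ∀ n, N ≤ n →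
      (padicValNat p₀ (MissingDigit.multOrder
        (UniqueFactorizationMonoid.radical (MissingDigit.coprimePart (a n) m)) m) : ℝ) ≤ γ n)
    (n₀ : ℕ) (hn₀ : N ≤ n₀)
    (hcut : ∀ n, n₀ ≤ n →
      (MissingDigit.overhead m p₀ : ℝ) + γ n
        + Real.logb (p₀ : ℝ) (MissingDigit.korobovConst m D) < α n) :
    (∀ n, n₀ ≤ n → 1 / (a n : ℝ) ∉ MissingDigit.missingDigitSet m D) ∧
      ({x : ℝ | ∃ n : ℕ, 1 ≤ n ∧ x = 1 / (a n : ℝ)} ∩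
        MissingDigit.missingDigitSet m D).Finite := by
  have hmain : ∀ n, n₀ ≤ n → 1 / (a n : ℝ) ∉ MissingDigit.missingDigitSet m D := by
    intro n hn
    have hA : a n ≠ 0 := by have := ha n (by omega); omega
    refine MissingDigit.one_div_notMem_missingDigitSet (by omega) hD hD_gt hD_lt hA hp₀ hp₀m ?_
    have h1 := hα n (by omega)
    have h2 := hγ n (by omega)
    have h3 := hcut n hn
    have hc := MissingDigit.two_mul_card_le_korobovConst hD_gt hD_lt
    have hq : (1 : ℝ) < D.card := by exact_mod_cast hD_gt
    have hp1 : (1 : ℝ) < p₀ := by exact_mod_cast hp₀.one_lt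
    set v := padicValNat p₀ (MissingDigit.coprimePart (a n) m)
    set g := padicValNat p₀ (MissingDigit.multOrder
        (UniqueFactorizationMonoid.radical (MissingDigit.coprimePart (a n) m)) m)
    set t := MissingDigit.overhead m p₀
    set c := MissingDigit.korobovConst m D
    have hpow : (0 : ℝ) < (p₀ : ℝ) ^ (t + g) := by positivity
    -- The cutoff hypothesis is the base-`p₀` logarithm of `c * p₀ ^ (t + g) < p₀ ^ v`, with `γ n`
    -- and `α n` bounding `g` above and `v` below.
    have hlog : Real.logb p₀ (c * (p₀ : ℝ) ^ (t + g)) < Real.logb p₀ ((p₀ : ℝ) ^ v) := by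
      rw [Real.logb_mul (by linarith) hpow.ne', Real.logb_pow, Real.logb_pow,
        Real.logb_self_eq_one hp1]
      push_cast
      linarith
    have hlt := (Real.logb_lt_logb_iff hp1 (mul_pos (by linarith) hpow) (by positivity)).mp hlog
    have : 2 * (D.card : ℝ) * (p₀ : ℝ) ^ (t + g) < (p₀ : ℝ) ^ v :=
      (mul_le_mul_of_nonneg_right hc hpow.le).trans_lt hlt
    exact_mod_cast this
  refine ⟨hmain, ((Set.finite_lt_nat n₀).image fun n => 1 / (a n : ℝ)).subset ?_⟩
  rintro x ⟨⟨n, -, rfl⟩, hx⟩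
  exact ⟨n, not_le.mp fun hn => hmain n hn hx, rfl⟩
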